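/- Let $\Phi:\mathbb R^3\to\mathbb R$ be a continuous spherically symmetric potential (a function of $\|x\|$, differentiable for $x\neq 0$), and for a constant $\Phi_0$ put $\Psi(x)=-\Phi(x)+\Phi_0$, $\mathcal E(x,v)=\Psi(x)-\tfrac12\langle v,v\rangle$, $L(x,v)=\|x\wedge v\|$. A function $f:\mathbb R^3\times\mathbb R^3\to\mathbb R$ is called a distribution function of a (bound) spherically symmetric steady-state system with potential $\Phi$ if the following hold. The function $f$ is invariant under simultaneous rotations and reflections of $x$ and $v$; $f>0$ where $\mathcal E>0$ and $f=0$ where $\mathcal E\le 0$; $f$ is continuous on $\{\mathcal E>0\}$; at all points with $\mathcal E>0$ and $L>0$ it is differentiable and satisfies the steady collisionless Boltzmann equation $\langle v,\nabla_x f\rangle-\langle\nabla\Phi,\nabla_v f\rangle=0$; and the accessible region $\{x:\Psi(x)>0\}$ is nonempty and connected. (It is all of $\mathbb R^3$ if $\Psi>0$ everywhere.) A bias function depending on position only is a function $\gamma:\mathbb R^3\to\mathbb R$ with $0<\gamma\le1$; it need not be spherically symmetric. Theorem 3. The product $\gamma(x)f(x,v)$, known on all of $\mathbb R^3\times\mathbb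 R^3$, determines $\gamma$ uniquely on the accessible region, up to the choice of the normalization of $f$. That is, let $f$ and $f'$ be distribution functions of spherically symmetric steady-state systems with (possibly different) potentials $\Phi,\Phi'$ and constants $\Phi_0,\Phi_0'$, and let $\gamma,\xi$ be bias functions depending on $x$ only, such that $\gamma(x)f(x,v)=\xi(x)f'(x,v)$ for all $(x,v)$. Then there is a constant $c>0$ with $\xi=c\,\gamma$ on $\{x:\Psi(x)>0\}$; and if $f$ and $f'$ have the same finite total $\iint f\,d^3x\,d^3v=\iint f'\,d^3x\,d^3v<\infty$ (for example, if both are probability densities), then $\xi=\gamma$ on $\{x:\Psi(x)>0\}$. -/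

import Mathlib

open MeasureTheory

noncomputable section

/-- Three-dimensional Euclidean space, used for positions and for velocities. -/
abbrev Space3 : Type := EuclideanSpace ℝ (Fin 3)

/-- The relative potential `Ψ = -Φ + Φ₀`. -/
def relPotential (Φ : Space3 → ℝ) (Φ₀ : ℝ) (x : Space3) : ℝ := -Φ x + Φ₀

/-- The relative energy `ℰ(x, v) = Ψ(x) - ⟨v, v⟩ / 2`. -/
def relEnergy (Φ : Space3 → ℝ) (Φ₀ : ℝ) (x v : Space3) : ℝ :=
  relPotential Φ Φ₀ x - (1 / 2 : ℝ) * inner ℝ v v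

/-- The magnitude `L(x, v) = ‖x ∧ v‖` of the angular momentum. -/
def angMomentum (x v : Space3) : ℝ :=
  ‖(WithLp.toLp 2 (crossProduct x.ofLp v.ofLp) : Space3)‖

/-- The positions accessible to the system: those at which bound velocities exist. -/
def accessibleRegion (Φ : Space3 → ℝ) (Φ₀ : ℝ) : Set Space3 :=
  {x | 0 < relPotential Φ Φ₀ x}

/-- The time-independent collisionless Boltzmann equation
`⟨v, ∇ₓ f⟩ - ⟨∇Φ, ∇ᵥ f⟩ = 0` at the phase-space point `(x, v)`. -/
def SteadyBoltzmannAt (Φ : Space3 → ℝ) (f : Space3 → Space3 → ℝ) (x v : Space3) : Prop :=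
  inner ℝ v (gradient (fun y => f y v) x)
    - inner ℝ (gradient Φ x) (gradient (fun w => f x w) v) = 0

/-- `f` is the distribution function of a bound, spherically symmetric steady-state system with
potential `Φ`; the constant `Φ₀` is the one for which the bound phase-space points, those that
carry matter, are exactly the points with `ℰ > 0`.

`L` is not differentiable where it vanishes, and radial profiles need not be differentiable at the
centre. Differentiability and the Boltzmann equation are therefore only asked for off the
radial orbits `L = 0`, where mere continuity is required, so that all functions `F(ℰ, L)` with
`F` continuous, and differentiable for `L > 0`, are included. -/
structure IsSphericalSteadyState (Φ : Space3 → ℝ) (Φ₀ : ℝ) (f : Space3 → Space3 → ℝ) : Prop where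
  /-- The potential is a function of `r = ‖x‖`. -/
  potential_radial : ∀ x y : Space3, ‖x‖ = ‖y‖ → Φ x = Φ y
  potential_continuous : Continuous Φ
  potential_differentiable : ∀ x : Space3, x ≠ 0 → DifferentiableAt ℝ Φ x
  /-- The system occupies a nonempty connected region of space. -/
  accessible_connected : IsConnected (accessibleRegion Φ Φ₀)
  /-- The distribution function has no preferred direction. -/
  rotation_invariant : ∀ (R : Space3 ≃ₗᵢ[ℝ] Space3) (x v : Space3), f (R x) (R v) = f x v
  pos_of_bound : ∀ x v : Space3, 0 < relEnergy Φ Φ₀ x v → 0 < f x v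
  zero_of_unbound : ∀ x v : Space3, relEnergy Φ Φ₀ x v ≤ 0 → f x v = 0
  continuous_bound : ContinuousOn (fun p : Space3 × Space3 => f p.1 p.2)
    {p | 0 < relEnergy Φ Φ₀ p.1 p.2}
  differentiable_bound : ∀ x v : Space3, 0 < relEnergy Φ Φ₀ x v → 0 < angMomentum x v →
    DifferentiableAt ℝ (fun p : Space3 × Space3 => f p.1 p.2) (x, v)
  steady : ∀ x v : Space3, 0 < relEnergy Φ Φ₀ x v → 0 < angMomentum x v →
    SteadyBoltzmannAt Φ f x v

/-- A bias (selection) function that depends on position only. -/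
def IsBiasFunction (γ : Space3 → ℝ) : Prop := ∀ x, 0 < γ x ∧ γ x ≤ 1

/-- The total amount of matter `∫∫ f d³x d³v` described by `f ≥ 0`, possibly infinite. -/
def totalMatter (f : Space3 → Space3 → ℝ) : ENNReal :=
  ∫⁻ p : Space3 × Space3, ENNReal.ofReal (f p.1 p.2)

end

/-!
Since `γ` and `ξ` are positive, the hypothesis says `f = g f'` with the position-dependent factor
`g = ξ / γ`. A distribution function is positive exactly where `|v|² < 2 Ψ(x)`, so the supports of
`f` and `f'` determine `Ψ` on the accessible region, and the two systems share this region and,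
on it, the force `-∇Φ`.

Away from the centre, `g` is a quotient of differentiable functions (take a fixed slow `v` that is
not parallel to `x`). Inserting `f = g f'` in the Boltzmann equation of `f` and subtracting
`g` times the one of `f'` leaves `f' ⟨v, ∇g⟩ = 0` for every slow `v` that is not parallel to `x`.
These `v` span space, so `∇g = 0` (`hasFDerivAt_ratio_of_ne_zero`). At the centre `g` is still
continuous, as the quotient of `f` and `f'` at `v = 0`, and the mean value theorem along rays gives
`∇g = 0` there too (`hasFDerivAt_zero_of_eventually_nhdsNE`). Connectedness of the accessible
region makes `g` a constant `c`. Then `f = c f'` on all of phase space, and comparing the totals,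
which are positive (`IsSphericalSteadyState.totalMatter_ne_zero`), gives `c = 1` whenever these
agree and are finite.
-/

open Filter Topology

/-- A function that is continuous at a point and has zero derivative at all nearby points has zero
derivative at the point itself. -/
lemma hasFDerivAt_zero_of_eventually_nhdsNE {E : Type*} [NormedAddCommGroup E] [NormedSpace ℝ E]
    {g : E → ℝ} {a : E} (hc : ContinuousAt g a)
    (hg : ∀ᶠ x in 𝓝[≠] a, HasFDerivAt g (0 : E →L[ℝ] ℝ) x) :
    HasFDerivAt g (0 : E →L[ℝ] ℝ) a := by
  obtain ⟨r, hr, hball⟩ := Metric.eventually_nhds_iff_ball.1 (eventually_nhdsWithin_iff.1 hg)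
  refine (hasFDerivAt_const (g a) a).congr_of_eventuallyEq ?_
  filter_upwards [Metric.ball_mem_nhds a hr] with y hy
  rcases eq_or_ne y a with rfl | hya
  · rfl
  have hd : ∀ t : ℝ, 0 < t → t ≤ 1 →
      HasDerivAt (fun t : ℝ => g (a + t • (y - a))) 0 t := by
    intro t ht ht1
    have hne : a + t • (y - a) ≠ a := by
      simp [ht.ne', sub_ne_zero.2 hya]
    have hmem : a + t • (y - a) ∈ Metric.ball a r := by
      rw [Metric.mem_ball, dist_eq_norm] at hy ⊢
      rw [add_sub_cancel_left, norm_smul, Real.norm_of_nonneg ht.le]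
      nlinarith [norm_nonneg (y - a)]
    have hline : HasDerivAt (fun t : ℝ => a + t • (y - a)) (y - a) t := by
      simpa using ((hasDerivAt_id t).smul_const (y - a)).const_add a
    simpa [Function.comp_def] using (hball _ hmem hne).comp_hasDerivAt t hline
  have hcont : ContinuousOn (fun t : ℝ => g (a + t • (y - a))) (Set.Icc 0 1) := by
    intro t ht
    rcases ht.1.eq_or_lt with rfl | ht0
    · have hline : ContinuousAt (fun t : ℝ => a + t • (y - a)) 0 := by fun_prop
      exact (ContinuousAt.comp (g := g) (by simpa using hc) hline).continuousWithinAt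
    · exact (hd t ht0 ht.2).continuousAt.continuousWithinAt
  obtain ⟨t, ht, hslope⟩ := exists_hasDerivAt_eq_slope _ (fun _ => (0 : ℝ)) zero_lt_one hcont
    fun t ht => hd t ht.1 ht.2.le
  simp only [one_smul, zero_smul, add_sub_cancel, add_zero, sub_zero, div_one] at hslope
  linarith

lemma exists_angMomentum_pos {x : Space3} (hx : x ≠ 0) : ∃ v, 0 < angMomentum x v := by
  by_contra! h
  have hc : ∀ w : Fin 3 → ℝ, crossProduct x.ofLp w = 0 := fun w => by
    simpa [angMomentum] using (norm_nonneg _).antisymm' (h (WithLp.toLp 2 w))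
  have h1 := hc ![1, 0, 0]
  have h2 := hc ![0, 1, 0]
  simp only [cross_apply] at h1 h2
  have e1 := congrFun h1 1
  have e2 := congrFun h1 2
  have e3 := congrFun h2 2
  simp at e1 e2 e3
  apply hx
  ext i
  fin_cases i <;> simp [e1, e2, e3]

lemma angMomentum_smul (x v : Space3) (t : ℝ) : angMomentum x (t • v) = |t| * angMomentum x v := by
  simp [angMomentum, norm_smul]

lemma relEnergy_zero (Φ : Space3 → ℝ) (Φ₀ : ℝ) (x : Space3) :
    relEnergy Φ Φ₀ x 0 = relPotential Φ Φ₀ x := by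
  simp [relEnergy]

lemma Continuous.relEnergy {Φ : Space3 → ℝ} (h : Continuous Φ) (Φ₀ : ℝ) :
    Continuous fun p : Space3 × Space3 => relEnergy Φ Φ₀ p.1 p.2 := by
  unfold _root_.relEnergy relPotential
  fun_prop

lemma isOpen_accessibleRegion {Φ : Space3 → ℝ} (h : Continuous Φ) (Φ₀ : ℝ) :
    IsOpen (accessibleRegion Φ Φ₀) :=
  isOpen_lt continuous_const (by unfold relPotential; fun_prop)

/-- Every direction that is not radial is the direction of a bound velocity, so a linear form that
vanishes on the bound velocities off the radial orbits is zero. -/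
lemma eq_zero_of_forall_bound {Φ : Space3 → ℝ} {Φ₀ : ℝ} {x : Space3} (hx : x ≠ 0)
    (hA : x ∈ accessibleRegion Φ Φ₀) {D : Space3 →L[ℝ] ℝ}
    (hD : ∀ v, 0 < relEnergy Φ Φ₀ x v → 0 < angMomentum x v → D v = 0) : D = 0 := by
  have hnonradial : ∀ w, 0 < angMomentum x w → D w = 0 := by
    intro w hw
    have hcont : Continuous fun t : ℝ => relEnergy Φ Φ₀ x (t • w) := by
      unfold relEnergy; fun_prop
    have hev : ∀ᶠ t : ℝ in 𝓝[>] 0, 0 < relEnergy Φ Φ₀ x (t • w) :=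
      (hcont.tendsto' 0 (relPotential Φ Φ₀ x) (by simp [relEnergy])).eventually_const_lt hA
        |>.filter_mono nhdsWithin_le_nhds
    obtain ⟨t, ht, ht0⟩ := (hev.and self_mem_nhdsWithin).exists
    have ht0 : 0 < t := ht0
    have := hD (t • w) ht (by rw [angMomentum_smul]; positivity)
    simpa [ht0.ne'] using this
  obtain ⟨u, hu⟩ := exists_angMomentum_pos hx
  ext w
  by_cases hw : 0 < angMomentum x w
  · exact hnonradial w hw
  -- A radial `w` is the difference of the non-radial vectors `w + u` and `u`.
  · have hw0 : crossProduct x.ofLp w.ofLp = 0 := by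
      simpa [angMomentum] using hw
    have hwu : 0 < angMomentum x (w + u) := by
      simpa [angMomentum, hw0] using hu
    have := hnonradial _ hwu
    rw [map_add, hnonradial u hu, add_zero] at this
    simpa using this

lemma exists_bound_nonradial {Φ : Space3 → ℝ} {Φ₀ : ℝ} {x : Space3} (hx : x ≠ 0)
    (hA : x ∈ accessibleRegion Φ Φ₀) :
    ∃ v, 0 < relEnergy Φ Φ₀ x v ∧ 0 < angMomentum x v := by
  by_contra! h
  have h1 (D : Space3 →L[ℝ] ℝ) : D = 0 :=
    eq_zero_of_forall_bound hx hA fun v hE hL => absurd hL (h v hE).not_gt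
  have h2 := h1 (innerSL ℝ x)
  have h3 := congrArg (fun D : Space3 →L[ℝ] ℝ => D x) h2
  simp [hx] at h3

namespace IsSphericalSteadyState

variable {Φ Φ' : Space3 → ℝ} {Φ₀ Φ₀' : ℝ} {f f' : Space3 → Space3 → ℝ} {g : Space3 → ℝ}

lemma pos_iff (hf : IsSphericalSteadyState Φ Φ₀ f) (x v : Space3) :
    0 < f x v ↔ 0 < relEnergy Φ Φ₀ x v :=
  ⟨fun h => by
    by_contra! hE
    exact h.ne' (hf.zero_of_unbound x v hE), hf.pos_of_bound x v⟩

lemma isOpen_bound (hf : IsSphericalSteadyState Φ Φ₀ f) :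
    IsOpen {p : Space3 × Space3 | 0 < relEnergy Φ Φ₀ p.1 p.2} :=
  isOpen_lt continuous_const (hf.potential_continuous.relEnergy Φ₀)

lemma totalMatter_ne_zero (hf : IsSphericalSteadyState Φ Φ₀ f) : totalMatter f ≠ 0 := by
  obtain ⟨x, hx⟩ := hf.accessible_connected.nonempty
  have hE : 0 < relEnergy Φ Φ₀ x 0 := (relEnergy_zero Φ Φ₀ x).symm ▸ hx
  have hfx : 0 < f x 0 := hf.pos_of_bound x 0 hE
  have hc : ContinuousAt (fun p : Space3 × Space3 => f p.1 p.2) (x, 0) :=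
    hf.continuous_bound.continuousAt (hf.isOpen_bound.mem_nhds hE)
  obtain ⟨U, hU, hUo, hxU⟩ := eventually_nhds_iff.1 (hc.eventually_const_lt (half_lt_self hfx))
  have hle : ENNReal.ofReal (f x 0 / 2) * volume U ≤ totalMatter f := by
    rw [← setLIntegral_const]
    refine (setLIntegral_mono' hUo.measurableSet fun p hp => ?_).trans (setLIntegral_le_lintegral U _)
    exact ENNReal.ofReal_le_ofReal (hU p hp).le
  refine (lt_of_lt_of_le ?_ hle).ne'
  exact ENNReal.mul_pos (by simpa using hfx) (hUo.measure_pos volume ⟨_, hxU⟩).ne'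

/-- The bound velocities at `x` form the ball of radius `√(2 Ψ(x))`, so the bound part of phase
space determines `Ψ` wherever it is positive. -/
lemma relPotential_eq (hE : ∀ x v, 0 < relEnergy Φ Φ₀ x v ↔ 0 < relEnergy Φ' Φ₀' x v)
    {x : Space3} (hx : x ∈ accessibleRegion Φ Φ₀) :
    relPotential Φ' Φ₀' x = relPotential Φ Φ₀ x := by
  have hx' : 0 < relPotential Φ' Φ₀' x := by
    rw [← relEnergy_zero, ← hE, relEnergy_zero]; exact hx
  have hx0 : 0 < relPotential Φ Φ₀ x := hx
  obtain ⟨e, he⟩ := exists_norm_eq Space3 zero_le_one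
  have key : ∀ s : ℝ, 0 ≤ s → (2 * s < 2 * relPotential Φ Φ₀ x ↔
      2 * s < 2 * relPotential Φ' Φ₀' x) := by
    intro s hs
    have hnorm : inner ℝ (√(2 * s) • e) (√(2 * s) • e) = 2 * s := by
      rw [real_inner_self_eq_norm_sq, norm_smul, he, mul_one, Real.norm_eq_abs, sq_abs,
        Real.sq_sqrt (by positivity)]
    have := hE x (√(2 * s) • e)
    simp only [relEnergy, hnorm] at this
    constructor <;> intro h
    · linarith [this.1 (by linarith)]
    · linarith [this.2 (by linarith)]
  refine le_antisymm ?_ ?_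
  · by_contra! h
    linarith [(key _ hx0.le).2 (by linarith)]
  · by_contra! h
    linarith [(key _ hx'.le).1 (by linarith)]

/-- Away from the centre the ratio `g` of two steady states with the same bound phase space has
zero derivative: the Boltzmann equations leave `f' ⟨v, ∇g⟩ = 0`. -/
lemma hasFDerivAt_ratio_of_ne_zero (hf : IsSphericalSteadyState Φ Φ₀ f)
    (hf' : IsSphericalSteadyState Φ' Φ₀' f') (hfg : ∀ x v, f x v = g x * f' x v)
    (hE : ∀ x v, 0 < relEnergy Φ Φ₀ x v ↔ 0 < relEnergy Φ' Φ₀' x v)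
    {x : Space3} (hx : x ∈ accessibleRegion Φ Φ₀) (hx0 : x ≠ 0) :
    HasFDerivAt g (0 : Space3 →L[ℝ] ℝ) x := by
  have hdx (f : Space3 → Space3 → ℝ) (v : Space3)
      (h : DifferentiableAt ℝ (fun p : Space3 × Space3 => f p.1 p.2) (x, v)) :
      DifferentiableAt ℝ (fun y => f y v) x :=
    DifferentiableAt.comp (g := fun p : Space3 × Space3 => f p.1 p.2) (f := fun y => (y, v)) x h
      (by fun_prop)
  have hdv (f : Space3 → Space3 → ℝ) (v : Space3)
      (h : DifferentiableAt ℝ (fun p : Space3 × Space3 => f p.1 p.2) (x, v)) :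
      DifferentiableAt ℝ (fun w => f x w) v :=
    DifferentiableAt.comp (g := fun p : Space3 × Space3 => f p.1 p.2) (f := fun w => (x, w)) v h
      (by fun_prop)
  have hgd : DifferentiableAt ℝ g x := by
    -- For a fixed bound `v` off the radial orbits, `g` is `f(·, v) / f'(·, v)` near `x`.
    obtain ⟨v, hv, hL⟩ := exists_bound_nonradial hx0 hx
    have h1 := hdx f v (hf.differentiable_bound x v hv hL)
    have h2 := hdx f' v (hf'.differentiable_bound x v ((hE x v).1 hv) hL)
    have hpos : 0 < f' x v := hf'.pos_of_bound x v ((hE x v).1 hv)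
    refine (h1.mul (h2.inv hpos.ne')).congr_of_eventuallyEq ?_
    filter_upwards [h2.continuousAt.eventually_const_lt hpos] with y hy
    simp [hfg, hy.ne']
  have hgrad : gradient Φ' x = gradient Φ x := by
    have hev : Φ' =ᶠ[𝓝 x] fun y => Φ y + (Φ₀' - Φ₀) := by
      filter_upwards [(isOpen_accessibleRegion hf.potential_continuous Φ₀).mem_nhds hx] with y hy
      have := relPotential_eq hE hy
      simp only [relPotential] at this
      linarith
    rw [hev.gradient_eq, gradient, gradient, fderiv_add_const]
  have hD : fderiv ℝ g x = 0 := by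
    refine eq_zero_of_forall_bound hx0 hx fun v hv hL => ?_
    have hv' := (hE x v).1 hv
    have h2 := hf'.differentiable_bound x v hv' hL
    have s1 := hf.steady x v hv hL
    have s2 := hf'.steady x v hv' hL
    have hpos : 0 < f' x v := hf'.pos_of_bound x v hv'
    have e1 : (fun y => f y v) = fun y => g y * f' y v := funext fun y => hfg y v
    have e2 : (fun w => f x w) = fun w => g x * f' x w := funext fun w => hfg x w
    have d1 := fderiv_fun_mul hgd (hdx f' v h2)
    have d2 := fderiv_const_mul (hdv f' v h2) (g x)
    simp only [SteadyBoltzmannAt, inner_gradient_right, conj_trivial, e1, e2, d1, d2, hgrad,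
      add_apply, smul_apply, smul_eq_mul] at s1 s2
    have : f' x v * fderiv ℝ g x v = 0 := by linear_combination s1 - g x * s2
    exact (mul_eq_zero.1 this).resolve_left hpos.ne'
  exact hD ▸ hgd.hasFDerivAt

lemma continuousAt_ratio (hf : IsSphericalSteadyState Φ Φ₀ f)
    (hf' : IsSphericalSteadyState Φ' Φ₀' f') (hfg : ∀ x v, f x v = g x * f' x v)
    (hE : ∀ x v, 0 < relEnergy Φ Φ₀ x v ↔ 0 < relEnergy Φ' Φ₀' x v)
    {x : Space3} (hx : x ∈ accessibleRegion Φ Φ₀) : ContinuousAt g x := by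
  have hx1 : 0 < relEnergy Φ Φ₀ x 0 := (relEnergy_zero Φ Φ₀ x).symm ▸ hx
  have hx2 := (hE x 0).1 hx1
  have h1 : ContinuousAt (fun y => f y 0) x :=
    ContinuousAt.comp (g := fun p : Space3 × Space3 => f p.1 p.2) (f := fun y => (y, 0))
      (hf.continuous_bound.continuousAt (hf.isOpen_bound.mem_nhds hx1)) (by fun_prop)
  have h2 : ContinuousAt (fun y => f' y 0) x :=
    ContinuousAt.comp (g := fun p : Space3 × Space3 => f' p.1 p.2) (f := fun y => (y, 0))
      (hf'.continuous_bound.continuousAt (hf'.isOpen_bound.mem_nhds hx2)) (by fun_prop)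
  have hpos : 0 < f' x 0 := hf'.pos_of_bound x 0 hx2
  refine (h1.div h2 hpos.ne').congr ?_
  filter_upwards [h2.eventually_const_lt hpos] with y hy
  simp [hfg, hy.ne']

/-- A position-dependent ratio of two steady states is constant on the accessible region. -/
lemma exists_ratio_eq (hf : IsSphericalSteadyState Φ Φ₀ f)
    (hf' : IsSphericalSteadyState Φ' Φ₀' f') (hfg : ∀ x v, f x v = g x * f' x v)
    (hE : ∀ x v, 0 < relEnergy Φ Φ₀ x v ↔ 0 < relEnergy Φ' Φ₀' x v) :
    ∃ c, ∀ x ∈ accessibleRegion Φ Φ₀, g x = c := by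
  have hopen := isOpen_accessibleRegion hf.potential_continuous Φ₀
  have hd : ∀ x ∈ accessibleRegion Φ Φ₀, HasFDerivAt g (0 : Space3 →L[ℝ] ℝ) x := by
    intro x hx
    by_cases hx0 : x = 0
    · refine hasFDerivAt_zero_of_eventually_nhdsNE (continuousAt_ratio hf hf' hfg hE hx) ?_
      filter_upwards [nhdsWithin_le_nhds (hopen.mem_nhds hx), self_mem_nhdsWithin] with y hy hy0
      exact hasFDerivAt_ratio_of_ne_zero hf hf' hfg hE hy fun h => hy0 (h.trans hx0.symm)
    · exact hasFDerivAt_ratio_of_ne_zero hf hf' hfg hE hx hx0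
  exact hopen.exists_is_const_of_fderiv_eq_zero hf.accessible_connected.isPreconnected
    (fun x hx => (hd x hx).differentiableAt.differentiableWithinAt) fun x hx => (hd x hx).fderiv

end IsSphericalSteadyState

theorem theorem3 (Φ Φ' : Space3 → ℝ) (Φ₀ Φ₀' : ℝ) (f f' : Space3 → Space3 → ℝ)
    (γ ξ : Space3 → ℝ)
    (hf : IsSphericalSteadyState Φ Φ₀ f) (hf' : IsSphericalSteadyState Φ' Φ₀' f')
    (hγ : IsBiasFunction γ) (hξ : IsBiasFunction ξ)
    (hprod : ∀ x v : Space3, γ x * f x v = ξ x * f' x v) :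
    (∃ c : ℝ, 0 < c ∧ ∀ x ∈ accessibleRegion Φ Φ₀, ξ x = c * γ x) ∧
    (totalMatter f = totalMatter f' → totalMatter f ≠ ⊤ →
      ∀ x ∈ accessibleRegion Φ Φ₀, ξ x = γ x) := by

  have hfg : ∀ x v, f x v = ξ x / γ x * f' x v := fun x v => by
    rw [div_mul_eq_mul_div, eq_div_iff (hγ x).1.ne', ← hprod]
    ring
  have hE : ∀ x v, 0 < relEnergy Φ Φ₀ x v ↔ 0 < relEnergy Φ' Φ₀' x v := fun x v => by
    rw [← hf.pos_iff, ← hf'.pos_iff, hfg, mul_pos_iff_of_pos_left (div_pos (hξ x).1 (hγ x).1)]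
  obtain ⟨c, hc⟩ := hf.exists_ratio_eq hf' hfg hE
  obtain ⟨x₀, hx₀⟩ := hf.accessible_connected.nonempty
  have hc0 : 0 < c := hc x₀ hx₀ ▸ div_pos (hξ x₀).1 (hγ x₀).1
  have hξγ : ∀ x ∈ accessibleRegion Φ Φ₀, ξ x = c * γ x := fun x hx =>
    (div_eq_iff (hγ x).1.ne').1 (hc x hx)
  refine ⟨⟨c, hc0, hξγ⟩, fun htot hfin x hx => ?_⟩
  have hfc : ∀ x v, f x v = c * f' x v := fun x v => by
    by_cases hx : x ∈ accessibleRegion Φ Φ₀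
    · rw [hfg, hc x hx]
    -- Outside the accessible region no velocity is bound, and both functions vanish.
    · have hv : relEnergy Φ Φ₀ x v ≤ 0 := by
        have h1 : relPotential Φ Φ₀ x ≤ 0 := not_lt.1 hx
        have h2 : 0 ≤ inner ℝ v v := real_inner_self_nonneg
        unfold relEnergy
        linarith
      rw [hf.zero_of_unbound x v hv,
        hf'.zero_of_unbound x v (not_lt.1 ((hE x v).not.1 hv.not_gt)), mul_zero]
  have hmul : totalMatter f = ENNReal.ofReal c * totalMatter f := by
    conv_lhs => rw [totalMatter]
    simp only [hfc, ENNReal.ofReal_mul hc0.le]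
    rw [lintegral_const_mul' _ _ ENNReal.ofReal_ne_top, htot, totalMatter]
  have hone : ENNReal.ofReal c = 1 := by
    refine (ENNReal.mul_left_inj hf.totalMatter_ne_zero hfin).1 ?_
    rw [← hmul, one_mul]
  rw [hξγ x hx, ENNReal.ofReal_eq_one.1 hone, one_mul]
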